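/- Let $k\ge 1$, let $G=(V,E)$ be a finite $k$-edge-connected undirected multigraph (any two distinct vertices are joined by $k$ edge-disjoint paths), and let $d\in V$ be the destination. Let $\vec G$ be the directed copy of $G$, in which each edge is replaced by its two opposite arcs. A $d$-rooted spanning arborescence of $\vec G$ is a set of arcs in which $d$ has no outgoing arc, every other vertex has exactly one outgoing arc, and a directed path leads from every vertex to $d$. A randomized routing function at a vertex $v$ maps the incoming edge of a packet (or the information that the packet originates at $v$) and the set of active (non-failed) edges incident with $v$ to a probability distribution on outgoing edges. A family of routing functions, one per vertex, is $c$-resilient if for every set $F\subseteq E$ of at most $c$ failed edges and every vertex $v$ joined to $d$ by a path in $G-F$, a packet that originates at $v$ reaches $d$ with probability $1$. Given pairwise arc-disjoint $d$-rooted spanning arborescences $\mathcal T=\{T_1,\dots,T_k\}$ of $\vec G$ and a parameter $q\in(0,1)$, the algorithm Bounced-Rand-Algo routes a packet as follows. Initially $T$ is an element of $\mathcal T$ chosen uniformly at random. Until $d$ is reached, the packet follows the arcs of $T$; whenever the next arc $(v,u)$ of $T$ belongs to a failed edge, then with probability $q$ the arborescence $T$ is replaced by a uniformly random element of $\mathcal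 T$, and with probability $1-q$ the packet bounces: $T$ is replaced by the element of $\mathcal T$ that contains the reversed arc $(u,v)$ of the same edge, or, if there is none, by an element of $\mathcal T$ drawn from some fixed distribution that depends only on $v$ and $T$ (any such rule is allowed). Since the arborescences are arc-disjoint, the arc over which a packet arrives determines $T$, so the algorithm is given by randomized routing functions. Theorem. For every such $G$, $d$ and $k$, a family $\mathcal T$ of $k$ pairwise arc-disjoint $d$-rooted spanning arborescences of $\vec G$ exists, and for every such family $\mathcal T$, every $q\in(0,1)$ and every such fallback rule, the routing functions produced by Bounced-Rand-Algo are $(k-1)$-resilient. -/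

import Mathlib

open scoped NNReal ENNReal

namespace ResilientRouting

/-! ### Multigraphs: walks, edge connectivity, arcs, arborescences -/

section Graphs

variable {α β : Type*}

/-- `IsWalk G x es y`: the list `es` is the sequence of edges of a walk from `x` to `y` in the
multigraph `G`. -/
inductive IsWalk (G : Graph α β) : α → List β → α → Prop
  | nil {x : α} (hx : x ∈ G.vertexSet) : IsWalk G x [] x
  | cons {x y z : α} {e : β} {es : List β} (h : G.IsLink e x y) (hw : IsWalk G y es z) :
      IsWalk G x (e :: es) z

/-- `G` is `k`-edge-connected: any two distinct vertices are joined by `k` pairwise edge-disjoint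
paths. (Every walk contains a path that uses only edges of the walk, so it is immaterial whether
one asks for walks or for paths.) -/
def EdgeConnected (G : Graph α β) (k : ℕ) : Prop :=
  ∀ u ∈ G.vertexSet, ∀ v ∈ G.vertexSet, u ≠ v →
    ∃ P : Fin k → List β, (∀ i, IsWalk G u (P i) v) ∧ ∀ i j, i ≠ j → List.Disjoint (P i) (P j)

/-- An arc, i.e. an edge together with a tail and a head. Parallel edges give different arcs. -/
@[ext]
structure Arc (α β : Type*) where
  edge : β
  tail : α
  head : α

/-- The same edge traversed in the opposite direction. -/
def Arc.reverse (a : Arc α β) : Arc α β := ⟨a.edge, a.head, a.tail⟩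

/-- `A` is the arc set of a `d`-rooted spanning arborescence of the directed copy of `G` (every
edge replaced by two opposite arcs): the root has no outgoing arc, every other vertex has exactly
one, and a directed path along arcs of `A` leads from every vertex to the root. -/
structure IsSpanningArborescence (G : Graph α β) (d : α) (A : Set (Arc α β)) : Prop where
  isLink : ∀ a ∈ A, G.IsLink a.edge a.tail a.head
  root_no_out : ∀ a ∈ A, a.tail ≠ d
  unique_out : ∀ v ∈ G.vertexSet, v ≠ d → ∃! a : Arc α β, a ∈ A ∧ a.tail = v
  reaches_root : ∀ v ∈ G.vertexSet,
    Relation.ReflTransGen (fun x y => ∃ e, (⟨e, x, y⟩ : Arc α β) ∈ A) v d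

/-- `T` is a family of `k` pairwise arc-disjoint `d`-rooted spanning arborescences. Two of them
may use the same edge, in opposite directions. -/
structure IsArcDisjointFamily (G : Graph α β) (d : α) {k : ℕ} (T : Fin k → Set (Arc α β)) :
    Prop where
  arborescence : ∀ i, IsSpanningArborescence G d (T i)
  disjoint : ∀ i j, i ≠ j → Disjoint (T i) (T j)

end Graphs

/-! ### Randomized routing functions and resilience -/

section Routing

variable {α β : Type*}

/-- A set of randomized routing functions, one for each vertex `v`. It maps the incoming edge of a
packet (`none` if the packet originates at `v`) and the set of active edges incident with `v` to a
probability distribution on outgoing edges; `none` means that the packet is not forwarded. -/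
abbrev RandomizedRouting (α β : Type*) := α → Option β → Set β → PMF (Option β)

/-- The position of a packet: `some (v, e)` if it is at `v` and has arrived over the edge `e`
(`none` if it originated at `v`), and `none` if it has been lost. -/
abbrev Position (α β : Type*) := Option (α × Option β)

/-- The edges incident with `v` that are active when the edges in `F` have failed. -/
def activeAt (G : Graph α β) (F : Set β) (v : α) : Set β := (G.deleteEdges F).incidenceSet v

open Classical in
/-- A packet at `v` is forwarded over an active edge incident with `v`, or else it is lost. -/
noncomputable def forward (G : Graph α β) (F : Set β) (v : α) : Option β → Position α β
  | none => none
  | some e => if h : (G.deleteEdges F).Inc e v then some (h.other, some e) else none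

open Classical in
/-- One hop of a packet with destination `d`, routed by `f` while the edges in `F` have failed.
The packet stays at `d` once it is there. -/
noncomputable def hop (G : Graph α β) (d : α) (f : RandomizedRouting α β) (F : Set β) :
    Position α β → PMF (Position α β)
  | none => PMF.pure none
  | some (v, inEdge) =>
      if v = d then PMF.pure (some (v, inEdge))
      else (f v inEdge (activeAt G F v)).map (forward G F v)

/-- The law of the position after `n` hops of a packet that originates at `v`: hops are made by
the vertices independently of each other. -/
noncomputable def positionLaw (G : Graph α β) (d : α) (f : RandomizedRouting α β) (F : Set β)
    (v : α) : ℕ → PMF (Position α β)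
  | 0 => PMF.pure (some (v, none))
  | n + 1 => (positionLaw G d f F v n).bind (hop G d f F)

/-- The probability that a packet originating at `v` ever reaches `d`. As packets stay at `d`, the
events "at `d` after `n` hops" increase with `n`, and their probabilities increase to that of
their union. -/
noncomputable def deliveryProb (G : Graph α β) (d : α) (f : RandomizedRouting α β) (F : Set β)
    (v : α) : ℝ≥0∞ :=
  ⨆ n : ℕ, (positionLaw G d f F v n).toOuterMeasure {s | ∃ inEdge, s = some (d, inEdge)}

/-- `f` is `c`-resilient: whenever at most `c` edges fail, a packet originated at any vertex `v`
that is still connected with `d` reaches `d` with probability one. -/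
def IsResilient (G : Graph α β) (d : α) (f : RandomizedRouting α β) (c : ℕ) : Prop :=
  ∀ F : Finset β, (F : Set β) ⊆ G.edgeSet → F.card ≤ c →
    ∀ v ∈ G.vertexSet, (∃ es, IsWalk (G.deleteEdges (F : Set β)) v es d) →
      deliveryProb G d f F v = 1

end Routing

/-! ### The exit distribution of a random process -/

section Exit

variable {ι β : Type*}

/-- The law after `n` steps of the random process on `ι` that starts with law `s`, moves by `step`
and stops as soon as it produces an output in `β`. -/
noncomputable def runLaw (step : ι → PMF (ι ⊕ β)) (s : PMF ι) : ℕ → PMF (ι ⊕ β)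
  | 0 => s.map Sum.inl
  | n + 1 => (runLaw step s n).bind (Sum.elim step fun e => PMF.pure (Sum.inr e))

/-- The probability that the process ever outputs `e`. -/
noncomputable def outputProb (step : ι → PMF (ι ⊕ β)) (s : PMF ι) (e : β) : ℝ≥0∞ :=
  ⨆ n : ℕ, runLaw step s n (Sum.inr e)

theorem runLaw_inr_monotone (step : ι → PMF (ι ⊕ β)) (s : PMF ι) (e : β) :
    Monotone fun n => runLaw step s n (Sum.inr e) := by
  refine monotone_nat_of_le_succ fun n => ?_
  simp only [runLaw, PMF.bind_apply]
  refine le_trans ?_ (ENNReal.le_tsum (Sum.inr e))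
  simp

theorem tsum_outputProb_le_one (step : ι → PMF (ι ⊕ β)) (s : PMF ι) :
    ∑' e, outputProb step s e ≤ 1 := by
  rw [ENNReal.tsum_eq_iSup_sum]
  refine iSup_le fun t => ?_
  simp only [outputProb]
  rw [ENNReal.finsetSum_iSup_of_monotone (runLaw_inr_monotone step s)]
  refine iSup_le fun n => ?_
  rw [← (runLaw step s n).tsum_coe]
  calc ∑ e ∈ t, runLaw step s n (Sum.inr e)
      ≤ ∑' e : β, runLaw step s n (Sum.inr e) := ENNReal.sum_le_tsum t
    _ ≤ ∑' x, runLaw step s n x :=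
        ENNReal.tsum_comp_le_tsum_of_injective Sum.inr_injective _

/-- The law of the output of the process; `none` if it never stops. -/
noncomputable def outputLaw (step : ι → PMF (ι ⊕ β)) (s : PMF ι) : PMF (Option β) :=
  ⟨fun o => o.elim (1 - ∑' e, outputProb step s e) (outputProb step s), by
    rw [ENNReal.summable.hasSum_iff, ← (Equiv.optionEquivSumPUnit.{0} β).symm.tsum_eq,
      Summable.tsum_sum ENNReal.summable ENNReal.summable]
    simpa using add_tsub_cancel_of_le (tsum_outputProb_le_one step s)⟩

end Exit

/-! ### The algorithm -/

section Algorithm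

variable {α β : Type*} {k : ℕ}

/-- A coin that shows `true` with probability `q`. -/
noncomputable def coin (q : ℝ≥0) (hq : q ≤ 1) : PMF Bool :=
  PMF.ofFintype (fun b => if b then (q : ℝ≥0∞) else ((1 - q : ℝ≥0) : ℝ≥0∞)) (by
    rw [Fintype.sum_bool]
    simp only [if_true, Bool.false_eq_true, if_false]
    rw [← ENNReal.coe_add, add_tsub_cancel_of_le hq, ENNReal.coe_one])

/-- The uniform distribution on the indices of the arborescences. -/
noncomputable def uniformIndex (k : ℕ) [NeZero k] : PMF (Fin k) := PMF.uniformOfFintype (Fin k)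

open Classical in
/-- The arborescence along which a packet at `v` is being routed: a packet that has just originated
gets a uniformly random one, and for a packet that came over an edge `e` it is the one that
contains the arc with which `e` enters `v`. (Packets routed by the algorithm only use arcs of
arborescences; the remaining case never arises.) -/
noncomputable def currentIndex [NeZero k] (T : Fin k → Set (Arc α β)) (v : α) :
    Option β → PMF (Fin k)
  | none => uniformIndex k
  | some e =>
      if h : ∃ i, ∃ u, (⟨e, u, v⟩ : Arc α β) ∈ T i then PMF.pure h.choose else uniformIndex k

open Classical in
/-- Bouncing at `v` on the failed arc of `T i` that leaves `v`: the new arborescence is the one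
that contains the reversed arc. If there is none, it is drawn from `fallback v i`. -/
noncomputable def bounce (T : Fin k → Set (Arc α β)) (fallback : α → Fin k → PMF (Fin k))
    (v : α) (i : Fin k) : PMF (Fin k) :=
  if h : ∃ j, ∃ a ∈ T i, a.tail = v ∧ a.reverse ∈ T j then PMF.pure h.choose else fallback v i

open Classical in
/-- One step of the algorithm at `v` while the packet is routed along `T i`. If the edge of the arc
of `T i` leaving `v` is active, the packet is sent over it. Otherwise, with probability `q` the
arborescence is replaced by a uniformly random one, and with probability `1 - q` the packet
bounces. -/
noncomputable def localStep [NeZero k] (T : Fin k → Set (Arc α β)) (q : ℝ≥0) (hq : q ≤ 1)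
    (fallback : α → Fin k → PMF (Fin k)) (v : α) (active : Set β) (i : Fin k) :
    PMF (Fin k ⊕ β) :=
  if h : ∃ a ∈ T i, a.tail = v ∧ a.edge ∈ active then PMF.pure (Sum.inr h.choose.edge)
  else (coin q hq).bind fun b =>
    (if b then uniformIndex k else bounce T fallback v i).map Sum.inl

/-- The randomized routing functions of the algorithm Bounced-Rand: every vertex repeats
`localStep`, beginning with the current arborescence of the packet, until the packet is sent. -/
noncomputable def bouncedRand [NeZero k] (T : Fin k → Set (Arc α β)) (q : ℝ≥0) (hq : q ≤ 1)
    (fallback : α → Fin k → PMF (Fin k)) : RandomizedRouting α β :=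
  fun v inEdge active =>
    outputLaw (localStep T q hq fallback v active) (currentIndex T v inEdge)

end Algorithm

end ResilientRouting

/-! Existence is Edmonds' theorem, proved after Lovász: `k` edge-disjoint walks to `d` give every
vertex set avoiding `d` at least `k` leaving arcs, and arborescences are peeled off one by one, each
grown arc by arc without ruining the remaining cuts (`exists_extending_arc`).

Resilience rests on a count (`IsArcDisjointFamily.exists_good_index`). Fewer than `k` failed edges
carry fewer than `2 * k` arcs. If each arborescence had a failed arc whose reversal lies on no
arborescence that is clean from there on, these `k` arcs and the reversals of `k` last failed arcs,
one per arborescence, would be `2 * k` distinct failed arcs. So some arborescence is good: wherever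
it fails, some other one leads cleanly to `d`. From any state the packet may redraw the good
arborescence at its first failure and the clean one at the next, so it arrives with positive
probability (`mayArrive`); redraws alone suffice, whatever bouncing does. A chain that can be
absorbed from every state of a finite closed set is absorbed almost surely (`hitProb_eq_one`); this
is applied both to the loop inside a vertex and to the hops. -/

namespace ResilientRouting

/-! ### Absorption of Markov chains -/

section Absorption

variable {X : Type*}

theorem tsum_iSup_of_monotone {f : ℕ → X → ℝ≥0∞} (hf : ∀ x, Monotone fun n => f n x) :
    ∑' x, ⨆ n, f n x = ⨆ n, ∑' x, f n x := by
  simp_rw [ENNReal.tsum_eq_iSup_sum, ENNReal.finsetSum_iSup_of_monotone hf]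
  exact iSup_comm

/-- The law after `n` steps of the Markov chain with kernel `κ` and initial law `μ`. -/
noncomputable def iterLaw (κ : X → PMF X) (μ : PMF X) : ℕ → PMF X
  | 0 => μ
  | n + 1 => (iterLaw κ μ n).bind κ

theorem iterLaw_succ' (κ : X → PMF X) (μ : PMF X) (n : ℕ) :
    iterLaw κ μ (n + 1) = iterLaw κ (μ.bind κ) n := by
  induction n with
  | zero => rfl
  | succ n ih => rw [iterLaw, ih, iterLaw]

theorem iterLaw_eq_bind (κ : X → PMF X) (μ : PMF X) (n : ℕ) :
    iterLaw κ μ n = μ.bind fun x => iterLaw κ (PMF.pure x) n := by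
  induction n with
  | zero => simp [iterLaw]
  | succ n ih => simp only [iterLaw]; rw [ih, PMF.bind_bind]

theorem iterLaw_toOuterMeasure_monotone {κ : X → PMF X} {A : Set X}
    (hA : ∀ x ∈ A, κ x = PMF.pure x) (μ : PMF X) :
    Monotone fun n => (iterLaw κ μ n).toOuterMeasure A := by
  refine monotone_nat_of_le_succ fun n => ?_
  simp only [iterLaw, PMF.toOuterMeasure_bind_apply]
  rw [PMF.toOuterMeasure_apply]
  refine ENNReal.tsum_le_tsum fun x => ?_
  by_cases hx : x ∈ A
  · simp [hx, hA x hx, PMF.toOuterMeasure_pure_apply]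
  · simp [hx]

theorem toOuterMeasure_le_one (μ : PMF X) (A : Set X) : μ.toOuterMeasure A ≤ 1 := by
  rw [PMF.toOuterMeasure_apply, ← μ.tsum_coe]
  exact ENNReal.tsum_le_tsum fun x => Set.indicator_le_self _ _ x

/-- The probability that the chain with kernel `κ` started at `x` is eventually in the absorbing
set `A`. -/
noncomputable def hitProb (κ : X → PMF X) (A : Set X) (x : X) : ℝ≥0∞ :=
  ⨆ n, (iterLaw κ (PMF.pure x) n).toOuterMeasure A

theorem hitProb_le_one (κ : X → PMF X) (A : Set X) (x : X) : hitProb κ A x ≤ 1 :=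
  iSup_le fun _ => toOuterMeasure_le_one _ _

theorem iSup_iterLaw_eq_tsum {κ : X → PMF X} {A : Set X}
    (hA : ∀ x ∈ A, κ x = PMF.pure x) (μ : PMF X) :
    ⨆ n, (iterLaw κ μ n).toOuterMeasure A = ∑' x, μ x * hitProb κ A x := by
  simp_rw [hitProb, ENNReal.mul_iSup]
  rw [tsum_iSup_of_monotone]
  · simp_rw [iterLaw_eq_bind κ μ, PMF.toOuterMeasure_bind_apply]
  · exact fun x m n h => mul_le_mul_right (iterLaw_toOuterMeasure_monotone hA _ h) _

/-- Condition on the first step: dropping the term `n = 0` does not change the supremum of a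
monotone sequence. -/
theorem hitProb_eq_tsum {κ : X → PMF X} {A : Set X}
    (hA : ∀ x ∈ A, κ x = PMF.pure x) (x : X) :
    hitProb κ A x = ∑' y, κ x y * hitProb κ A y := by
  rw [← iSup_iterLaw_eq_tsum hA, hitProb,
    ← (iterLaw_toOuterMeasure_monotone hA (PMF.pure x)).iSup_nat_add 1]
  simp_rw [iterLaw_succ', PMF.pure_bind]

/-- If from every state of a finite closed set the absorbing set `A` can be reached, then the chain
started in that set is absorbed almost surely. -/
theorem hitProb_eq_one {κ : X → PMF X} {A S : Set X}
    (hA : ∀ x ∈ A, κ x = PMF.pure x) (hS : S.Finite)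
    (hcl : ∀ x ∈ S, (κ x).support ⊆ S)
    (hreach : ∀ x ∈ S, ∃ y ∈ A, Relation.ReflTransGen (fun x y => y ∈ (κ x).support) x y)
    {x : X} (hx : x ∈ S) : hitProb κ A x = 1 := by
  -- Minimum principle: `hitProb` is harmonic, so its minimum over `S` is inherited by all
  -- successors of a minimizer, and hence by a point of `A`, where the value is 1.
  obtain ⟨s, hs, hmin⟩ := Set.exists_min_image S (hitProb κ A) hS ⟨x, hx⟩
  have key : ∀ y, Relation.ReflTransGen (fun x y => y ∈ (κ x).support) s y →
      y ∈ S ∧ hitProb κ A y = hitProb κ A s := by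
    intro y hy
    induction hy with
    | refl => exact ⟨hs, rfl⟩
    | @tail b c _ hbc ih =>
      obtain ⟨hb, hbs⟩ := ih
      have hc := hcl b hb hbc
      refine ⟨hc, le_antisymm ?_ (hmin c hc)⟩
      by_contra! hlt
      have h1 : ∑' z, κ b z * hitProb κ A s = hitProb κ A s := by
        rw [ENNReal.tsum_mul_right, PMF.tsum_coe, one_mul]
      have hfin : hitProb κ A s ≠ ∞ := ((hitProb_le_one κ A s).trans_lt ENNReal.one_lt_top).ne
      have h2 : ∑' z, κ b z * hitProb κ A s < ∑' z, κ b z * hitProb κ A z := by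
        refine ENNReal.tsum_lt_tsum (i := c) (by rwa [h1]) (fun z => ?_) ?_
        · by_cases hz : z ∈ (κ b).support
          · exact mul_le_mul_right (hmin z (hcl b hb hz)) _
          · simp [(PMF.apply_eq_zero_iff _ _).2 hz]
        · exact ENNReal.mul_lt_mul_right hbc (PMF.apply_ne_top _ _) hlt
      rw [h1, ← hitProb_eq_tsum hA, hbs] at h2
      exact lt_irrefl _ h2
  obtain ⟨y, hyA, hy⟩ := hreach s hs
  have hy1 : hitProb κ A y = 1 := by
    refine le_antisymm (hitProb_le_one _ _ _) (le_trans ?_ (le_iSup _ 0))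
    simp [iterLaw, PMF.toOuterMeasure_pure_apply, hyA]
  refine le_antisymm (hitProb_le_one _ _ _) ?_
  rw [← hy1, (key y hy).2]
  exact hmin x hx

theorem iSup_iterLaw_eq_one {κ : X → PMF X} {A S : Set X}
    (hA : ∀ x ∈ A, κ x = PMF.pure x) (hS : S.Finite)
    (hcl : ∀ x ∈ S, (κ x).support ⊆ S)
    (hreach : ∀ x ∈ S, ∃ y ∈ A, Relation.ReflTransGen (fun x y => y ∈ (κ x).support) x y)
    {μ : PMF X} (hμ : μ.support ⊆ S) : ⨆ n, (iterLaw κ μ n).toOuterMeasure A = 1 := by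
  rw [iSup_iterLaw_eq_tsum hA, ← μ.tsum_coe]
  refine tsum_congr fun x => ?_
  by_cases hx : x ∈ μ.support
  · rw [hitProb_eq_one hA hS hcl hreach (hμ hx), mul_one]
  · simp [(PMF.apply_eq_zero_iff _ _).2 hx]

theorem exists_mem_support_iterLaw {κ : X → PMF X} {μ : PMF X} {x y : X} (hx : x ∈ μ.support)
    (h : Relation.ReflTransGen (fun x y => y ∈ (κ x).support) x y) :
    ∃ n, y ∈ (iterLaw κ μ n).support := by
  induction h with
  | refl => exact ⟨0, hx⟩
  | tail _ hbc ih =>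
    obtain ⟨n, hn⟩ := ih
    exact ⟨n + 1, (PMF.mem_support_bind_iff _ _ _).2 ⟨_, hn, hbc⟩⟩

theorem support_iterLaw_subset {κ : X → PMF X} {μ : PMF X} {S : Set X} (hμ : μ.support ⊆ S)
    (hcl : ∀ x ∈ S, (κ x).support ⊆ S) (n : ℕ) : (iterLaw κ μ n).support ⊆ S := by
  induction n with
  | zero => exact hμ
  | succ n ih =>
    intro y hy
    obtain ⟨x, hx, hxy⟩ := (PMF.mem_support_bind_iff _ _ _).1 hy
    exact hcl x (ih hx) hxy

end Absorption

/-! ### The process inside one vertex -/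

section Output

variable {ι β : Type*}

/-- The kernel of the process of `runLaw`: outputs are absorbing. -/
noncomputable def runKernel (step : ι → PMF (ι ⊕ β)) : ι ⊕ β → PMF (ι ⊕ β) :=
  Sum.elim step fun e => PMF.pure (Sum.inr e)

theorem runLaw_eq_iterLaw (step : ι → PMF (ι ⊕ β)) (s : PMF ι) (n : ℕ) :
    runLaw step s n = iterLaw (runKernel step) (s.map Sum.inl) n := by
  induction n with
  | zero => rfl
  | succ n ih => rw [runLaw, ih]; rfl

theorem some_mem_support_outputLaw {step : ι → PMF (ι ⊕ β)} {s : PMF ι} {e : β} :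
    some e ∈ (outputLaw step s).support ↔ ∃ n, Sum.inr e ∈ (runLaw step s n).support := by
  rw [PMF.mem_support_iff]
  change (⨆ n : ℕ, runLaw step s n (Sum.inr e)) ≠ 0 ↔ _
  simp [PMF.mem_support_iff]

/-- The mass of `none` is the defect of the output probabilities; exchanging sum and supremum makes
it the probability of never stopping. -/
theorem none_notMem_support_outputLaw {step : ι → PMF (ι ⊕ β)} {s : PMF ι}
    (h : ⨆ n, (runLaw step s n).toOuterMeasure (Set.range Sum.inr) = 1) :
    none ∉ (outputLaw step s).support := by
  rw [PMF.mem_support_iff, not_not]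
  change 1 - ∑' e, outputProb step s e = 0
  simp only [outputProb]
  rw [tsum_iSup_of_monotone (runLaw_inr_monotone step s), tsub_eq_zero_iff_le, ← h]
  refine iSup_mono fun n => ?_
  rw [PMF.toOuterMeasure_apply, ← tsum_subtype, tsum_range _ Sum.inr_injective]

end Output

/-! ### Edmonds' theorem on disjoint branchings -/

section Branchings

variable {α β : Type*}

open Classical in
/-- The arcs of `B` that leave `U`. -/
noncomputable def outArcs (B : Finset (Arc α β)) (U : Finset α) : Finset (Arc α β) :=
  B.filter fun a => a.tail ∈ U ∧ a.head ∉ U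

theorem mem_outArcs {B : Finset (Arc α β)} {U : Finset α} {a : Arc α β} :
    a ∈ outArcs B U ↔ a ∈ B ∧ a.tail ∈ U ∧ a.head ∉ U := by
  simp [outArcs]

open Classical in
-- The inequality holds arc by arc; it is strict only for arcs joining `U \ W` and `W \ U`.
theorem card_outArcs_submodular (B : Finset (Arc α β)) (U W : Finset α) :
    (outArcs B (U ∩ W)).card + (outArcs B (U ∪ W)).card ≤
      (outArcs B U).card + (outArcs B W).card := by
  simp only [outArcs, Finset.card_filter, ← Finset.sum_add_distrib]
  refine Finset.sum_le_sum fun a _ => ?_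
  simp only [Finset.mem_inter, Finset.mem_union]
  by_cases h1 : a.tail ∈ U <;> by_cases h2 : a.tail ∈ W <;> by_cases h3 : a.head ∈ U <;>
    by_cases h4 : a.head ∈ W <;> simp [h1, h2, h3, h4]

/-- Every nonempty set of vertices that avoids `d` is left by at least `k` arcs of `B`. -/
def HasCuts (V : Finset α) (d : α) (B : Finset (Arc α β)) (k : ℕ) : Prop :=
  ∀ U ⊆ V, d ∉ U → U.Nonempty → k ≤ (outArcs B U).card

/-- `A` is the arc set of an arborescence with root `d` and vertex set `W`. -/
structure IsArborescenceOn (W : Finset α) (d : α) (A : Finset (Arc α β)) : Prop where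
  root_mem : d ∈ W
  tail_mem : ∀ a ∈ A, a.tail ∈ W
  root_no_out : ∀ a ∈ A, a.tail ≠ d
  unique_out : ∀ v ∈ W, v ≠ d → ∃! a : Arc α β, a ∈ A ∧ a.tail = v
  reaches_root : ∀ v ∈ W,
    Relation.ReflTransGen (fun x y => ∃ e, (⟨e, x, y⟩ : Arc α β) ∈ A) v d

open Classical in
theorem IsArborescenceOn.insert {W : Finset α} {d : α} {A : Finset (Arc α β)}
    (h : IsArborescenceOn W d A) {a : Arc α β} (ht : a.tail ∉ W) (hh : a.head ∈ W) :
    IsArborescenceOn (insert a.tail W) d (insert a A) where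
  root_mem := Finset.mem_insert_of_mem h.root_mem
  tail_mem := by
    intro b hb
    rcases Finset.mem_insert.1 hb with rfl | hb
    · exact Finset.mem_insert_self _ _
    · exact Finset.mem_insert_of_mem (h.tail_mem b hb)
  root_no_out := by
    intro b hb
    rcases Finset.mem_insert.1 hb with rfl | hb
    · rintro h'
      exact ht (h' ▸ h.root_mem)
    · exact h.root_no_out b hb
  unique_out := by
    intro v hv hvd
    rcases Finset.mem_insert.1 hv with rfl | hvW
    · refine ⟨a, ⟨Finset.mem_insert_self _ _, rfl⟩, ?_⟩
      rintro b ⟨hb, hbt⟩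
      rcases Finset.mem_insert.1 hb with rfl | hb
      · rfl
      · exact absurd (hbt ▸ h.tail_mem b hb) ht
    · obtain ⟨b, ⟨hb, hbt⟩, huniq⟩ := h.unique_out v hvW hvd
      refine ⟨b, ⟨Finset.mem_insert_of_mem hb, hbt⟩, ?_⟩
      rintro c ⟨hc, hct⟩
      rcases Finset.mem_insert.1 hc with rfl | hc
      · exact absurd (hct ▸ hvW) ht
      · exact huniq c ⟨hc, hct⟩
  reaches_root := by
    have key : ∀ v ∈ W, Relation.ReflTransGen
        (fun x y => ∃ e, (⟨e, x, y⟩ : Arc α β) ∈ Insert.insert a A) v d := fun v hv =>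
      Relation.ReflTransGen.mono
        (fun x y ⟨e, he⟩ => ⟨e, Finset.mem_insert_of_mem he⟩) _ _ (h.reaches_root v hv)
    intro v hv
    rcases Finset.mem_insert.1 hv with rfl | hv
    · exact (key _ hh).head ⟨a.edge, Finset.mem_insert_self _ _⟩
    · exact key v hv

open Classical in
/-- An arborescence that does not yet span all vertices can be extended by an arc without spoiling
the cut condition for the remaining arcs. -/
theorem exists_extending_arc {V W : Finset α} {d : α} {A B : Finset (Arc α β)} {k : ℕ}
    (hB : ∀ a ∈ B, a.tail ∈ V ∧ a.head ∈ V) (hcut : HasCuts V d B (k + 1))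
    (hWV : W ⊆ V) (hne : W ≠ V) (hA : IsArborescenceOn W d A) (hrest : HasCuts V d (B \ A) k) :
    ∃ a ∈ B, a.tail ∉ W ∧ a.head ∈ W ∧ HasCuts V d (B \ insert a A) k := by
  have hd := hA.root_mem
  -- Tight sets not contained in `W`. The last clause admits `V` as the only member containing `d`,
  -- so that a smallest member exists even if no set is tight.
  let P : Finset α → Prop := fun U =>
    U ⊆ V ∧ (U \ W).Nonempty ∧ (outArcs (B \ A) U).card ≤ k ∧ (d ∈ U → U = V)
  have hVW : (V \ W).Nonempty := by
    rw [Finset.sdiff_nonempty]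
    exact fun h => hne (hWV.antisymm h)
  have hPV : P V := by
    refine ⟨subset_rfl, hVW, ?_, fun _ => rfl⟩
    have : outArcs (B \ A) V = ∅ := by
      ext a
      simp only [mem_outArcs, Finset.notMem_empty, iff_false, Finset.mem_sdiff]
      exact fun h => h.2.2 (hB a h.1.1).2
    simp [this]
  obtain ⟨U, hUP, hmin⟩ : ∃ U, P U ∧ ∀ U', P U' → U.card ≤ U'.card := by
    obtain ⟨U, hU, hm⟩ := Set.exists_min_image {U | P U} Finset.card
      (V.powerset.finite_toSet.subset fun U hU => by simpa using hU.1) ⟨V, hPV⟩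
    exact ⟨U, hU, hm⟩
  obtain ⟨hUV, hUW, hUk, hUd⟩ := hUP
  -- Arcs of `A` start in `W`, so this cut has lost none. As at most `k` arcs leave `U`, some arc
  -- runs from `U \ W` into `U ∩ W`.
  have hbig : k + 1 ≤ (outArcs (B \ A) (U \ W)).card := by
    have heq : outArcs (B \ A) (U \ W) = outArcs B (U \ W) := by
      ext a
      simp only [mem_outArcs, Finset.mem_sdiff]
      exact ⟨fun h => ⟨h.1.1, h.2⟩, fun h => ⟨⟨h.1, fun ha => h.2.1.2 (hA.tail_mem a ha)⟩, h.2⟩⟩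
    rw [heq]
    exact hcut _ (Finset.sdiff_subset.trans hUV) (by simp [hd]) hUW
  obtain ⟨a, ha, haU⟩ : ∃ a ∈ outArcs (B \ A) (U \ W), a ∉ outArcs (B \ A) U := by
    by_contra! h
    have := Finset.card_le_card (show outArcs (B \ A) (U \ W) ⊆ outArcs (B \ A) U from h)
    omega
  simp only [mem_outArcs, Finset.mem_sdiff] at ha haU
  obtain ⟨⟨haB, haA⟩, ⟨htU, htW⟩, hh⟩ := ha
  have hhU : a.head ∈ U := by
    by_contra h
    exact haU ⟨⟨haB, haA⟩, htU, h⟩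
  have hhW : a.head ∈ W := by
    by_contra h
    exact hh ⟨hhU, h⟩
  refine ⟨a, haB, htW, hhW, ?_⟩
  intro X hXV hdX hX
  -- A violated `X` must be tight and left by `a`.
  by_contra! hlt
  have hsd : outArcs (B \ insert a A) X = (outArcs (B \ A) X).erase a := by
    ext b
    simp only [mem_outArcs, Finset.mem_sdiff, Finset.mem_insert, Finset.mem_erase]
    tauto
  have hXk := hrest X hXV hdX hX
  rw [hsd] at hlt
  have haX : a ∈ outArcs (B \ A) X := by
    by_contra h
    rw [Finset.erase_eq_of_notMem h] at hlt
    omega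
  rw [Finset.card_erase_of_mem haX] at hlt
  obtain ⟨-, htX, hhX⟩ := mem_outArcs.1 haX
  -- If `d ∉ U`, at least `k` arcs leave `U ∪ X`, and submodularity leaves at most `k` for `U ∩ X`.
  -- If `d ∈ U`, then `U = V` and the intersection is `X`.
  have hPUX : P (U ∩ X) := by
    refine ⟨Finset.inter_subset_left.trans hUV, ⟨a.tail, by simp [htU, htX, htW]⟩, ?_,
      fun h => absurd (Finset.mem_inter.1 h).2 hdX⟩
    by_cases hdU : d ∈ U
    · rw [hUd hdU, Finset.inter_eq_right.2 hXV]
      omega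
    · have := card_outArcs_submodular (B \ A) U X
      have := hrest (U ∪ X) (Finset.union_subset hUV hXV) (by simp [hdU, hdX])
        ⟨a.tail, by simp [htU]⟩
      omega
  -- Minimality gives `U ⊆ X`, but the head of `a` lies in `U` and not in `X`.
  have hle := hmin _ hPUX
  have := Finset.eq_of_subset_of_card_le Finset.inter_subset_left hle
  exact hhX (Finset.mem_inter.1 (this ▸ hhU)).2

open Classical in
-- Grow from `{d}`, by induction on the number of uncovered vertices.
theorem exists_arborescence_hasCuts {V : Finset α} {d : α} (hd : d ∈ V) {B : Finset (Arc α β)}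
    {k : ℕ} (hB : ∀ a ∈ B, a.tail ∈ V ∧ a.head ∈ V) (hcut : HasCuts V d B (k + 1)) :
    ∃ A ⊆ B, IsArborescenceOn V d A ∧ HasCuts V d (B \ A) k := by
  have key : ∀ n, ∀ W ⊆ V, ∀ A ⊆ B, (V \ W).card = n → IsArborescenceOn W d A →
      HasCuts V d (B \ A) k → ∃ A ⊆ B, IsArborescenceOn V d A ∧ HasCuts V d (B \ A) k := by
    intro n
    induction n with
    | zero =>
      intro W hWV A hAB hn hA hrest
      rw [Finset.card_eq_zero, Finset.sdiff_eq_empty_iff_subset] at hn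
      obtain rfl := hWV.antisymm hn
      exact ⟨A, hAB, hA, hrest⟩
    | succ n ih =>
      intro W hWV A hAB hn hA hrest
      have hne : W ≠ V := by
        rintro rfl
        simp at hn
      obtain ⟨a, haB, ht, hh, hcut'⟩ := exists_extending_arc hB hcut hWV hne hA hrest
      refine ih (insert a.tail W) (Finset.insert_subset (hB a haB).1 hWV) (insert a A)
        (Finset.insert_subset haB hAB) ?_ (hA.insert ht hh) hcut'
      rw [Finset.sdiff_insert, Finset.card_erase_of_mem (by simp [ht, (hB a haB).1]), hn]
      rfl
  refine key _ {d} (by simpa using hd) ∅ (by simp) rfl ?_ ?_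
  · exact ⟨by simp, by simp, by simp, by simp, by simp [Relation.ReflTransGen.refl]⟩
  · intro U hU hdU hne
    rw [Finset.sdiff_empty]
    exact (Nat.le_succ k).trans (hcut U hU hdU hne)

open Classical in
/-- Edmonds' theorem on disjoint branchings. -/
theorem exists_disjoint_arborescences {V : Finset α} {d : α} (hd : d ∈ V) (k : ℕ) :
    ∀ {B : Finset (Arc α β)}, (∀ a ∈ B, a.tail ∈ V ∧ a.head ∈ V) → HasCuts V d B k →
    ∃ T : Fin k → Finset (Arc α β), (∀ i, T i ⊆ B) ∧ (∀ i, IsArborescenceOn V d (T i)) ∧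
      ∀ i j, i ≠ j → Disjoint (T i) (T j) := by
  induction k with
  | zero => exact fun _ _ => ⟨Fin.elim0, fun i => i.elim0, fun i => i.elim0, fun i => i.elim0⟩
  | succ k ih =>
    intro B hB hcut
    obtain ⟨A, hAB, hA, hrest⟩ := exists_arborescence_hasCuts hd hB hcut
    obtain ⟨T, hTB, hT, hdisj⟩ := ih (fun a ha => hB a (Finset.sdiff_subset ha)) hrest
    have hAT : ∀ i, Disjoint A (T i) := fun i =>
      Finset.disjoint_of_subset_right (hTB i) Finset.disjoint_sdiff
    refine ⟨Fin.cons A T, ?_, ?_, ?_⟩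
    · refine Fin.cases ?_ fun i => ?_
      · simpa using hAB
      · simpa using (hTB i).trans Finset.sdiff_subset
    · refine Fin.cases ?_ fun i => ?_
      · simpa using hA
      · simpa using hT i
    · refine Fin.cases ?_ fun i => ?_ <;> refine Fin.cases ?_ fun j => ?_
      · simp
      · exact fun _ => hAT j
      · simpa using (hAT i).symm
      · simpa using fun h => hdisj i j h

theorem IsWalk.exists_leaving {G : Graph α β} {x y : α} {es : List β} (h : IsWalk G x es y)
    {U : Set α} (hx : x ∈ U) (hy : y ∉ U) :
    ∃ a : Arc α β, a.edge ∈ es ∧ G.IsLink a.edge a.tail a.head ∧ a.tail ∈ U ∧ a.head ∉ U := by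
  induction h with
  | nil => exact absurd hx hy
  | @cons x z y e es hl hw ih =>
    by_cases hz : z ∈ U
    · obtain ⟨a, ha, h⟩ := ih hz hy
      exact ⟨a, List.mem_cons_of_mem _ ha, h⟩
    · exact ⟨⟨e, x, z⟩, List.mem_cons_self, hl, hx, hz⟩

/-- For the cut condition, each of `k` edge-disjoint walks from a vertex of `U` to `d` supplies an
arc leaving `U`; their edges differ, hence so do the arcs. -/
theorem exists_isArcDisjointFamily (G : Graph α β) (hV : G.vertexSet.Finite)
    (hE : G.edgeSet.Finite) {d : α} (hd : d ∈ G.vertexSet) {k : ℕ} (hG : EdgeConnected G k) :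
    ∃ T : Fin k → Set (Arc α β), IsArcDisjointFamily G d T := by
  have hfin : {a : Arc α β | G.IsLink a.edge a.tail a.head}.Finite := by
    refine Set.Finite.of_injOn (f := fun a : Arc α β => (a.edge, a.tail, a.head))
      (t := G.edgeSet ×ˢ G.vertexSet ×ˢ G.vertexSet) ?_ ?_ (hE.prod (hV.prod hV))
    · exact fun a ha => ⟨ha.edge_mem, ha.left_mem, ha.right_mem⟩
    · intro a _ b _ h
      simp only [Prod.mk.injEq] at h
      exact Arc.ext h.1 h.2.1 h.2.2
  obtain ⟨T, hTB, hT, hdisj⟩ := exists_disjoint_arborescences (V := hV.toFinset) (d := d)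
    (by simpa using hd) k (B := hfin.toFinset)
    (fun a ha => by
      have ha : G.IsLink a.edge a.tail a.head := by simpa using ha
      simpa using ⟨ha.left_mem, ha.right_mem⟩)
    (by
      rintro U hUV hdU ⟨u, hu⟩
      obtain ⟨P, hP, hPd⟩ := hG u (by simpa using hUV hu) d hd (by rintro rfl; exact hdU hu)
      choose f hfP hfl hft hfh using fun i => (hP i).exists_leaving (U := (U : Set α)) hu hdU
      have hinj : Function.Injective f := by
        intro i j hij
        by_contra hne
        exact hPd i j hne (hfP i) (hij ▸ hfP j)
      rw [← Fintype.card_fin k, ← Finset.card_univ]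
      refine Finset.card_le_card_of_injOn f (fun i _ => ?_) hinj.injOn
      exact mem_outArcs.2 ⟨by simpa using hfl i, hft i, hfh i⟩)
  refine ⟨fun i => T i, fun i => ⟨fun a ha => ?_, (hT i).root_no_out, fun v hv => ?_,
    fun v hv => ?_⟩, fun i j h => by simpa using hdisj i j h⟩
  · simpa using hTB i ha
  · exact (hT i).unique_out v (by simpa using hv)
  · exact (hT i).reaches_root v (by simpa using hv)

end Branchings

/-! ### Counting failed arcs -/

section FailedArcs

variable {α β : Type*} {G : Graph α β} {d : α} {k : ℕ} {T : Fin k → Set (Arc α β)}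

theorem IsSpanningArborescence.eq_of_tail_eq {A : Set (Arc α β)}
    (h : IsSpanningArborescence G d A) {a b : Arc α β} (ha : a ∈ A) (hb : b ∈ A)
    (hab : a.tail = b.tail) : a = b :=
  (h.unique_out b.tail (h.isLink b hb).left_mem (h.root_no_out b hb)).unique ⟨ha, hab⟩ ⟨hb, rfl⟩

theorem IsArcDisjointFamily.index_eq (hT : IsArcDisjointFamily G d T) {i j : Fin k}
    {a : Arc α β} (hi : a ∈ T i) (hj : a ∈ T j) : i = j := by
  by_contra h
  exact Set.disjoint_left.1 (hT.disjoint i j h) hi hj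

/-- A path along arcs of `A` whose edges are not in `F`. -/
def CleanPath (A : Set (Arc α β)) (F : Set β) : α → α → Prop :=
  Relation.ReflTransGen fun x y => ∃ e, (⟨e, x, y⟩ : Arc α β) ∈ A ∧ e ∉ F

theorem cleanPath_or_exists_last_failure {A : Set (Arc α β)} (F : Set β) {v : α}
    (h : Relation.ReflTransGen (fun x y => ∃ e, (⟨e, x, y⟩ : Arc α β) ∈ A) v d) :
    CleanPath A F v d ∨ ∃ a ∈ A, a.edge ∈ F ∧ CleanPath A F a.head d := by
  induction h using Relation.ReflTransGen.head_induction_on with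
  | refl => exact Or.inl .refl
  | @head x y hxy _ ih =>
    rcases ih with ih | ih
    · obtain ⟨e, he⟩ := hxy
      by_cases heF : e ∈ F
      · exact Or.inr ⟨_, he, heF, ih⟩
      · exact Or.inl (.head ⟨e, he, heF⟩ ih)
    · exact Or.inr ih

open Classical in
theorem exists_finset_failed_arcs (F : Finset β) (hF : (F : Set β) ⊆ G.edgeSet) :
    ∃ S : Finset (Arc α β), S.card ≤ 2 * F.card ∧
      ∀ a : Arc α β, G.IsLink a.edge a.tail a.head → a.edge ∈ F → a ∈ S := by
  rcases isEmpty_or_nonempty α with _ | _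
  · exact ⟨∅, by simp, fun a => isEmptyElim a.tail⟩
  choose! x y hxy using fun e (he : e ∈ F) => G.exists_isLink_of_mem_edgeSet (hF he)
  refine ⟨F.image (fun e => ⟨e, x e, y e⟩) ∪ F.image (fun e => ⟨e, y e, x e⟩), ?_, ?_⟩
  · refine (Finset.card_union_le _ _).trans ?_
    rw [two_mul]
    exact add_le_add Finset.card_image_le Finset.card_image_le
  · rintro ⟨e, u, v⟩ hl he
    rw [Finset.mem_union, Finset.mem_image, Finset.mem_image]
    rcases hl.eq_and_eq_or_eq_and_eq (hxy e he) with ⟨h1, h2⟩ | ⟨h1, h2⟩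
    · exact Or.inl ⟨e, he, Arc.ext rfl h1.symm h2.symm⟩
    · exact Or.inr ⟨e, he, Arc.ext rfl h1.symm h2.symm⟩

/-- If fewer than `k` edges fail, some arborescence is such that bouncing on any of its failed arcs
leads to an arborescence along which there is no further failure. -/
theorem IsArcDisjointFamily.exists_good_index (hT : IsArcDisjointFamily G d T) {F : Finset β}
    (hF : (F : Set β) ⊆ G.edgeSet) (hFk : F.card < k) :
    ∃ i, ∀ a ∈ T i, a.edge ∈ F → ∃ j, a.reverse ∈ T j ∧ CleanPath (T j) F a.tail d := by
  by_contra! hbad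
  choose b hbT hbF hb using hbad
  -- The last failure on the way from `b i` to `d`, possibly `b i` itself.
  have hlast : ∀ i, ∃ a ∈ T i, a.edge ∈ F ∧ CleanPath (T i) F a.head d := by
    intro i
    rcases cleanPath_or_exists_last_failure (F : Set β)
      ((hT.arborescence i).reaches_root (b i).head
        ((hT.arborescence i).isLink _ (hbT i)).right_mem) with h | h
    · exact ⟨b i, hbT i, hbF i, h⟩
    · exact h
  choose h hhT hhF hh using hlast
  obtain ⟨S, hSc, hS⟩ := exists_finset_failed_arcs F hF
  -- In the mixed case `b i = (h j).reverse`, the reversal of `b i` is `h j`, after which `T j` is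
  -- clean, contrary to the choice of `b i`.
  have hinj : Function.Injective (Sum.elim b fun i => (h i).reverse) := by
    rintro (i | i) (j | j) hij
    · simp only [Sum.elim_inl] at hij
      exact congrArg _ (hT.index_eq (hbT i) (hij ▸ hbT j))
    · simp only [Sum.elim_inl, Sum.elim_inr] at hij
      refine absurd ?_ (hb i j (by rw [hij]; exact hhT j))
      rw [hij]
      exact hh j
    · simp only [Sum.elim_inl, Sum.elim_inr] at hij
      refine absurd ?_ (hb j i (by rw [← hij]; exact hhT i))
      rw [← hij]
      exact hh i
    · simp only [Sum.elim_inr] at hij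
      have hij' : h i = h j := congrArg Arc.reverse hij
      exact congrArg _ (hT.index_eq (hhT i) (hij' ▸ hhT j))
  have hcard : (Finset.univ : Finset (Fin k ⊕ Fin k)).card ≤ S.card := by
    refine Finset.card_le_card_of_injOn _ ?_ hinj.injOn
    rintro (i | i) _
    · exact hS _ ((hT.arborescence i).isLink _ (hbT i)) (hbF i)
    · exact hS _ ((hT.arborescence i).isLink _ (hhT i)).symm (hhF i)
  simp only [Finset.card_univ, Fintype.card_sum, Fintype.card_fin] at hcard
  omega

/-- The `k` arcs leaving `v`, one per arborescence, lie on distinct edges: arcs with the same edge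
and tail coincide. -/
theorem IsArcDisjointFamily.exists_active_arc (hT : IsArcDisjointFamily G d T) {F : Finset β}
    (hFk : F.card < k) {v : α} (hv : v ∈ G.vertexSet) (hvd : v ≠ d) :
    ∃ i, ∃ a ∈ T i, a.tail = v ∧ a.edge ∉ F := by
  by_contra! h
  choose f hf _ using fun i => (hT.arborescence i).unique_out v hv hvd
  have hinj : Function.Injective fun i => (f i).edge := by
    intro i j hij
    simp only at hij
    have hi := (hT.arborescence i).isLink _ (hf i).1
    have hj := (hT.arborescence j).isLink _ (hf j).1
    rw [(hf i).2, hij] at hi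
    rw [(hf j).2] at hj
    have : f i = f j := Arc.ext hij ((hf i).2.trans (hf j).2.symm) (hi.right_unique hj)
    exact hT.index_eq (hf i).1 (this ▸ (hf j).1)
  have := Finset.card_le_card_of_injOn (s := Finset.univ) (t := F) _
    (fun i _ => h i _ (hf i).1 (hf i).2) hinj.injOn
  rw [Finset.card_univ, Fintype.card_fin] at this
  omega

theorem mem_activeAt_iff {F : Set β} {a : Arc α β} (ha : G.IsLink a.edge a.tail a.head) :
    a.edge ∈ activeAt G F a.tail ↔ a.edge ∉ F := by
  simp [activeAt, ha.inc_left]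

end FailedArcs

/-! ### Positive probability of delivery, and resilience -/

section Delivery

variable {α β : Type*} {G : Graph α β} {d : α} {k : ℕ} [NeZero k] {T : Fin k → Set (Arc α β)}
  {q : ℝ≥0} {hq : q ≤ 1} {fallback : α → Fin k → PMF (Fin k)}

theorem localStep_of_active (hT : IsArcDisjointFamily G d T) {i : Fin k} {a : Arc α β}
    (ha : a ∈ T i) {active : Set β} (hact : a.edge ∈ active) :
    localStep T q hq fallback a.tail active i = PMF.pure (Sum.inr a.edge) := by
  have h : ∃ b ∈ T i, b.tail = a.tail ∧ b.edge ∈ active := ⟨a, ha, rfl, hact⟩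
  rw [localStep, dif_pos h,
    (hT.arborescence i).eq_of_tail_eq h.choose_spec.1 ha h.choose_spec.2.1]

/-- The coin calls for a redraw with positive probability, and a redraw can yield any index. -/
theorem mem_support_localStep_of_failed (hq0 : 0 < q) {v : α} {active : Set β} {i : Fin k}
    (h : ¬ ∃ a ∈ T i, a.tail = v ∧ a.edge ∈ active) (j : Fin k) :
    Sum.inl j ∈ (localStep T q hq fallback v active i).support := by
  rw [localStep, dif_neg h, PMF.mem_support_bind_iff]
  refine ⟨true, ?_, ?_⟩
  · simpa [coin, PMF.mem_support_ofFintype_iff] using hq0.ne'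
  · simp [uniformIndex]

theorem exists_arc_of_mem_support_localStep {v : α} {active : Set β} {i : Fin k} {e : β}
    (h : Sum.inr e ∈ (localStep T q hq fallback v active i).support) :
    ∃ a ∈ T i, a.tail = v ∧ a.edge ∈ active ∧ e = a.edge := by
  rw [localStep] at h
  split_ifs at h with hex
  · rw [PMF.mem_support_pure_iff, Sum.inr.injEq] at h
    exact ⟨_, hex.choose_spec.1, hex.choose_spec.2.1, hex.choose_spec.2.2, h⟩
  · rw [PMF.mem_support_bind_iff] at h
    obtain ⟨b, -, hb⟩ := h
    simp at hb

/-- Edge and head determine the tail, and arc-disjointness then determines the index, whatever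
`choose` picks. -/
theorem currentIndex_head (hT : IsArcDisjointFamily G d T) {i : Fin k} {a : Arc α β}
    (ha : a ∈ T i) : currentIndex T a.head (some a.edge) = PMF.pure i := by
  have h : ∃ i, ∃ u, (⟨a.edge, u, a.head⟩ : Arc α β) ∈ T i := ⟨i, a.tail, ha⟩
  obtain ⟨u, hu⟩ := h.choose_spec
  have hl : G.IsLink a.edge u a.head := (hT.arborescence _).isLink _ hu
  have hua : (⟨a.edge, u, a.head⟩ : Arc α β) = a :=
    Arc.ext rfl (hl.left_unique ((hT.arborescence i).isLink a ha)) rfl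
  rw [hua] at hu
  simp only [currentIndex]
  rw [dif_pos h, hT.index_eq hu ha]

theorem forward_arc {F : Set β} {a : Arc α β} (ha : G.IsLink a.edge a.tail a.head)
    (haF : a.edge ∉ F) : forward G F a.tail (some a.edge) = some (a.head, some a.edge) := by
  have h : (G.deleteEdges F).Inc a.edge a.tail := Graph.deleteEdges_inc.2 ⟨ha.inc_left, haF⟩
  have hl : G.IsLink a.edge a.tail h.other := h.isLink_other.1
  rw [forward, dif_pos h, hl.right_unique ha]

variable (T q hq fallback) in
/-- The kernel of the local process at `v`. -/
noncomputable abbrev localKernel (v : α) (active : Set β) : Fin k ⊕ β → PMF (Fin k ⊕ β) :=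
  runKernel (localStep T q hq fallback v active)

variable (G T q hq fallback) in
/-- A packet at `v` that arrived over `o` may come to be routed along `T j`. -/
def MayFollow (F : Set β) (v : α) (o : Option β) (j : Fin k) : Prop :=
  ∃ i ∈ (currentIndex T v o).support,
    Relation.ReflTransGen
      (fun x y => y ∈ (localKernel T q hq fallback v (activeAt G F v) x).support)
      (Sum.inl i) (Sum.inl j)

theorem mayFollow_of_mem {F : Set β} {v : α} {o : Option β} {j : Fin k}
    (h : j ∈ (currentIndex T v o).support) : MayFollow G T q hq fallback F v o j :=
  ⟨j, h, .refl⟩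

theorem mayFollow_head (hT : IsArcDisjointFamily G d T) {F : Set β} {i : Fin k} {a : Arc α β}
    (ha : a ∈ T i) : MayFollow G T q hq fallback F a.head (some a.edge) i :=
  mayFollow_of_mem (by rw [currentIndex_head hT ha]; simp)

theorem MayFollow.switch (hT : IsArcDisjointFamily G d T) (hq0 : 0 < q) {F : Set β}
    {o : Option β} {i : Fin k} {a : Arc α β} (ha : a ∈ T i) (haF : a.edge ∈ F)
    (h : MayFollow G T q hq fallback F a.tail o i) (j : Fin k) :
    MayFollow G T q hq fallback F a.tail o j := by
  obtain ⟨i₀, hi₀, hi⟩ := h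
  refine ⟨i₀, hi₀, hi.tail (mem_support_localStep_of_failed hq0 ?_ j)⟩
  rintro ⟨b, hb, hbt, hbe⟩
  rw [(hT.arborescence i).eq_of_tail_eq hb ha hbt,
    mem_activeAt_iff ((hT.arborescence i).isLink a ha)] at hbe
  exact hbe haF

theorem MayFollow.mem_support_hop (hT : IsArcDisjointFamily G d T) {F : Set β}
    {o : Option β} {i : Fin k} {a : Arc α β} (ha : a ∈ T i) (haF : a.edge ∉ F)
    (h : MayFollow G T q hq fallback F a.tail o i) :
    some (a.head, some a.edge) ∈
      (hop G d (bouncedRand T q hq fallback) F (some (a.tail, o))).support := by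
  have hl := (hT.arborescence i).isLink a ha
  obtain ⟨i₀, hi₀, hi⟩ := h
  rw [hop, if_neg ((hT.arborescence i).root_no_out a ha), PMF.mem_support_map_iff]
  refine ⟨some a.edge, ?_, forward_arc hl haF⟩
  rw [bouncedRand, some_mem_support_outputLaw]
  simp_rw [runLaw_eq_iterLaw]
  refine exists_mem_support_iterLaw (x := Sum.inl i₀) (by simpa using hi₀) (hi.tail ?_)
  change _ ∈ (localStep T q hq fallback a.tail (activeAt G F a.tail) i).support
  rw [localStep_of_active hT ha ((mem_activeAt_iff hl).2 haF)]
  simp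

variable (G d T q hq fallback) in
/-- A packet at `v` that arrived over `o` reaches `d` with positive probability. -/
def MayArrive (F : Set β) (v : α) (o : Option β) : Prop :=
  ∃ o', Relation.ReflTransGen
    (fun x y => y ∈ (hop G d (bouncedRand T q hq fallback) F x).support)
    (some (v, o)) (some (d, o'))

theorem MayFollow.mayArrive_of_head (hT : IsArcDisjointFamily G d T) {F : Set β}
    {o : Option β} {i : Fin k} {a : Arc α β} (ha : a ∈ T i) (haF : a.edge ∉ F)
    (h : MayFollow G T q hq fallback F a.tail o i)
    (hh : MayArrive G d T q hq fallback F a.head (some a.edge)) :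
    MayArrive G d T q hq fallback F a.tail o := by
  obtain ⟨o', ho'⟩ := hh
  exact ⟨o', ho'.head (h.mem_support_hop hT ha haF)⟩

theorem mayArrive_of_cleanPath (hT : IsArcDisjointFamily G d T) {F : Set β} {j : Fin k} {v : α}
    (hp : CleanPath (T j) F v d) {o : Option β} (h : MayFollow G T q hq fallback F v o j) :
    MayArrive G d T q hq fallback F v o := by
  induction hp using Relation.ReflTransGen.head_induction_on generalizing o with
  | refl => exact ⟨o, .refl⟩
  | head hxy _ ih =>
    obtain ⟨e, he, heF⟩ := hxy
    exact MayFollow.mayArrive_of_head (a := ⟨e, _, _⟩) hT he heF h (ih (mayFollow_head hT he))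

/-- To show that a packet following `T i` may arrive, it suffices to treat the vertices at which it
meets a failed arc. -/
theorem mayArrive_of_failures (hT : IsArcDisjointFamily G d T) {F : Set β} {i : Fin k}
    (hfail : ∀ a ∈ T i, a.edge ∈ F → ∀ o, MayFollow G T q hq fallback F a.tail o i →
      MayArrive G d T q hq fallback F a.tail o)
    {v : α} (hv : v ∈ G.vertexSet) {o : Option β} (h : MayFollow G T q hq fallback F v o i) :
    MayArrive G d T q hq fallback F v o := by
  have hp := (hT.arborescence i).reaches_root v hv
  clear hv
  induction hp using Relation.ReflTransGen.head_induction_on generalizing o with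
  | refl => exact ⟨o, .refl⟩
  | head hxy _ ih =>
    obtain ⟨e, he⟩ := hxy
    by_cases heF : e ∈ F
    · exact hfail _ he heF o h
    · exact MayFollow.mayArrive_of_head (a := ⟨e, _, _⟩) hT he heF h (ih (mayFollow_head hT he))

theorem mayArrive (hT : IsArcDisjointFamily G d T) (hq0 : 0 < q) {F : Finset β}
    (hF : (F : Set β) ⊆ G.edgeSet) (hFk : F.card < k) {v : α} (hv : v ∈ G.vertexSet)
    (o : Option β) : MayArrive G d T q hq fallback F v o := by
  obtain ⟨g, hg⟩ := hT.exists_good_index hF hFk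
  obtain ⟨i, hi⟩ := (currentIndex T v o).support_nonempty
  refine mayArrive_of_failures hT (fun a ha haF o' h => ?_) hv (mayFollow_of_mem hi)
  refine mayArrive_of_failures hT (fun b hb hbF o'' h' => ?_)
    ((hT.arborescence i).isLink a ha).left_mem (h.switch hT hq0 ha haF g)
  obtain ⟨j, -, hj⟩ := hg b hb hbF
  -- The clean arborescence is reached by a redraw, not by the bounce.
  exact mayArrive_of_cleanPath hT hj (h'.switch hT hq0 hb hbF j)

/-- Some arborescence has an active arc at `v` and a redraw may pick it, so the local loop stops
almost surely and no packet is lost. -/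
theorem exists_arc_of_mem_support_bouncedRand (hT : IsArcDisjointFamily G d T)
    (hE : G.edgeSet.Finite) (hq0 : 0 < q) {F : Finset β} (hFk : F.card < k) {v : α}
    (hv : v ∈ G.vertexSet) (hvd : v ≠ d) {o x : Option β}
    (hx : x ∈ (bouncedRand T q hq fallback v o (activeAt G F v)).support) :
    ∃ i, ∃ a ∈ T i, a.tail = v ∧ a.edge ∉ F ∧ x = some a.edge := by
  set κ := localKernel T q hq fallback v (activeAt G F v)
  let S : Set (Fin k ⊕ β) := Set.range Sum.inl ∪
    Sum.inr '' {e | ∃ i, ∃ a ∈ T i, a.tail = v ∧ a.edge ∉ F ∧ e = a.edge}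
  have hSfin : S.Finite := by
    refine (Set.finite_range _).union ((hE.subset ?_).image _)
    rintro e ⟨i, a, ha, -, -, rfl⟩
    exact ((hT.arborescence i).isLink a ha).edge_mem
  have hcl : ∀ y ∈ S, (κ y).support ⊆ S := by
    rintro (i | e) hy (j | e') hz
    · exact Or.inl ⟨j, rfl⟩
    · obtain ⟨a, ha, rfl, hact, rfl⟩ := exists_arc_of_mem_support_localStep hz
      exact Or.inr ⟨_, ⟨i, a, ha, rfl,
        (mem_activeAt_iff ((hT.arborescence i).isLink a ha)).1 hact, rfl⟩, rfl⟩
    · exact Or.inl ⟨j, rfl⟩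
    · have hz : Sum.inr e' ∈ (PMF.pure (Sum.inr e : Fin k ⊕ β)).support := hz
      rw [PMF.mem_support_pure_iff] at hz
      rwa [hz]
  have hμ : ((currentIndex T v o).map (Sum.inl : Fin k → Fin k ⊕ β)).support ⊆ S := by
    rw [PMF.support_map]
    rintro _ ⟨i, -, rfl⟩
    exact Or.inl ⟨i, rfl⟩
  rw [bouncedRand] at hx
  rcases x with - | e
  · refine absurd hx (none_notMem_support_outputLaw ?_)
    simp_rw [runLaw_eq_iterLaw]
    refine iSup_iterLaw_eq_one (S := S) ?_ hSfin hcl ?_ hμ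
    · rintro _ ⟨e, rfl⟩
      rfl
    · have hout : ∀ i : Fin k, (∃ a ∈ T i, a.tail = v ∧ a.edge ∈ activeAt G F v) →
          ∃ e, Sum.inr e ∈ (κ (Sum.inl i)).support := by
        rintro i ⟨a, ha, rfl, hact⟩
        refine ⟨a.edge, ?_⟩
        change _ ∈ (localStep T q hq fallback a.tail (activeAt G F a.tail) i).support
        rw [localStep_of_active hT ha hact]
        simp
      rintro (i | e) -
      · by_cases h : ∃ a ∈ T i, a.tail = v ∧ a.edge ∈ activeAt G F v
        · obtain ⟨e, he⟩ := hout i h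
          exact ⟨_, ⟨e, rfl⟩, .single he⟩
        · obtain ⟨j, a, ha, rfl, haF⟩ := hT.exists_active_arc hFk hv hvd
          obtain ⟨e, he⟩ := hout j
            ⟨a, ha, rfl, (mem_activeAt_iff ((hT.arborescence j).isLink a ha)).2 haF⟩
          exact ⟨_, ⟨e, rfl⟩, .head (mem_support_localStep_of_failed hq0 h j) (.single he)⟩
      · exact ⟨_, ⟨e, rfl⟩, .refl⟩
  · rw [some_mem_support_outputLaw] at hx
    obtain ⟨n, hn⟩ := hx
    rw [runLaw_eq_iterLaw] at hn
    rcases support_iterLaw_subset hμ hcl n hn with ⟨i, hi⟩ | ⟨e', he', h⟩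
    · cases hi
    · obtain rfl := Sum.inr_injective h
      obtain ⟨i, a, ha, hav, haF, rfl⟩ := he'
      exact ⟨i, a, ha, hav, haF, rfl⟩

theorem positionLaw_eq_iterLaw (f : RandomizedRouting α β) (F : Set β) (v : α) (n : ℕ) :
    positionLaw G d f F v n = iterLaw (hop G d f F) (PMF.pure (some (v, none))) n := by
  induction n with
  | zero => rfl
  | succ n ih => rw [positionLaw, ih]; rfl

theorem isResilient_bouncedRand (hV : G.vertexSet.Finite) (hE : G.edgeSet.Finite)
    (hT : IsArcDisjointFamily G d T) (hq0 : 0 < q) :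
    IsResilient G d (bouncedRand T q hq fallback) (k - 1) := by
  intro F hF hFk v hv _
  have hk : F.card < k := by
    have := NeZero.pos k
    omega
  simp_rw [deliveryProb, positionLaw_eq_iterLaw]
  -- The lost position is left out, since `d` cannot be reached from it; `S` is closed because no
  -- packet in it gets lost.
  let S : Set (Position α β) := some '' (G.vertexSet ×ˢ insert none (some '' G.edgeSet))
  refine hitProb_eq_one (S := S) ?_ ((hV.prod ((hE.image _).insert _)).image _) ?_ ?_ ?_
  · rintro _ ⟨o, rfl⟩
    simp [hop]
  · rintro _ ⟨⟨u, o⟩, ⟨hu, ho⟩, rfl⟩ y hy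
    rw [hop] at hy
    split_ifs at hy with hud
    · rw [PMF.mem_support_pure_iff] at hy
      exact hy ▸ ⟨(u, o), ⟨hu, ho⟩, rfl⟩
    · rw [PMF.mem_support_map_iff] at hy
      obtain ⟨x, hx, rfl⟩ := hy
      obtain ⟨i, a, ha, rfl, haF, rfl⟩ :=
        exists_arc_of_mem_support_bouncedRand hT hE hq0 hk hu hud hx
      have hl := (hT.arborescence i).isLink a ha
      rw [forward_arc hl haF]
      exact ⟨_, ⟨hl.right_mem, Or.inr ⟨_, hl.edge_mem, rfl⟩⟩, rfl⟩
  · rintro _ ⟨⟨u, o⟩, ⟨hu, -⟩, rfl⟩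
    obtain ⟨o', ho'⟩ := mayArrive (hq := hq) (fallback := fallback) hT hq0 hF hk hu o
    exact ⟨_, ⟨o', rfl⟩, ho'⟩
  · exact ⟨(v, none), ⟨hv, Or.inl rfl⟩, rfl⟩

end Delivery

end ResilientRouting

theorem mainTheorem4 {α β : Type*} (G : Graph α β)
    (hV : G.vertexSet.Finite) (hE : G.edgeSet.Finite)
    (d : α) (hd : d ∈ G.vertexSet) (k : ℕ) [NeZero k]
    (hG : ResilientRouting.EdgeConnected G k) :
    (∃ T : Fin k → Set (ResilientRouting.Arc α β),
      ResilientRouting.IsArcDisjointFamily G d T) ∧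
    ∀ T : Fin k → Set (ResilientRouting.Arc α β),
      ResilientRouting.IsArcDisjointFamily G d T →
      ∀ (q : ℝ≥0) (_ : 0 < q) (hq : q < 1) (fallback : α → Fin k → PMF (Fin k)),
        ResilientRouting.IsResilient G d
          (ResilientRouting.bouncedRand T q hq.le fallback) (k - 1) :=
  ⟨ResilientRouting.exists_isArcDisjointFamily G hV hE hd hG,
    fun _ hT _ hq0 _ _ => ResilientRouting.isResilient_bouncedRand hV hE hT hq0⟩
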